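/- Let $n\ge 1$ and let $M(n,\mathbf H)$ be the ring of $n\times n$ matrices over the real Hamilton quaternions $\mathbf H$. For $\sigma\in S_n$ and an index $i$, write $\sigma$ as a product of $r$ disjoint cycles (fixed points included), $\sigma=c_1c_2\cdots c_r$, so that $c_1$ is the cycle through $i$, written starting with $i$, each of the other cycles is written starting with its smallest element, and these smallest elements increase from $c_2$ to $c_r$. For $A=(a_{pq})\in M(n,\mathbf H)$ and a cycle $c$ that starts with $p$, has length $\ell$ and is contained in $\sigma$, put $a_c=a_{p,\sigma(p)}\,a_{\sigma(p),\sigma^2(p)}\cdots a_{\sigma^{\ell-1}(p),p}$. The $i$th row and column determinants of $A$ are $$\mathrm{rdet}_i A=\sum_{\sigma\in S_n}(-1)^{n-r}a_{c_1}a_{c_2}\cdots a_{c_r},\qquad \mathrm{cdet}_i A=\sum_{\sigma\in S_n}(-1)^{n-r}a_{c_r}\cdots a_{c_2}a_{c_1}.$$ Let $A^*$ be the conjugate transpose of $A$. Then for every $A\in M(n,\mathbf H)$ the quaternions $\mathrm{rdet}_i(AA^*)$, $\mathrm{cdet}_i(AA^*)$, $\mathrm{rdet}_i(A^*A)$, $\mathrm{cdet}_i(A^*A)$,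 $1\le i\le n$, all have the same value, which is called the double determinant $\mathrm{ddet}\,A$ of $A$; and for all $A,B\in M(n,\mathbf H)$, $$\mathrm{ddet}(A\cdot B)=\mathrm{ddet}\,A\cdot\mathrm{ddet}\,B.$$ -/

import Mathlib

namespace RowColDet

open Equiv

variable {n : ℕ}

/-- The product of the entries of `A` along the cycle of `σ` through `i`, read from `i`:
`a_{i, σ i} a_{σ i, σ² i} ⋯ a_{σ⁻¹ i, i}`. A fixed point `i` contributes `a_{i i}`. -/
noncomputable def cycleProd {R : Type*} [Ring R] (A : Matrix (Fin n) (Fin n) R) (σ : Perm (Fin n))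
    (i : Fin n) : R :=
  ((List.range (Function.minimalPeriod σ i)).map
    fun k => A ((σ ^ k) i) ((σ ^ (k + 1)) i)).prod

/-- The first elements of the disjoint cycles of `σ` (fixed points included), in the ordered
cycle notation that begins with the index `i`: first `i` itself, then, in increasing order, the
smallest elements of those cycles that do not contain `i`. -/
def cycleStarts (σ : Perm (Fin n)) (i : Fin n) : List (Fin n) :=
  i :: (List.finRange n).filter fun j => ¬ σ.SameCycle i j ∧ ∀ k, σ.SameCycle j k → j ≤ k

/-- The `i`th row determinant: in each monomial the cycles are multiplied from left to right in
the order `cycleStarts σ i`, so that the cycle through `i` comes first. The sign of `σ` is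
`(-1) ^ (n - r)`, where `r` is the number of its cycles. -/
noncomputable def rdet {R : Type*} [Ring R] (i : Fin n) (A : Matrix (Fin n) (Fin n) R) : R :=
  ∑ σ : Perm (Fin n), ((Perm.sign σ : ℤ) : R) * ((cycleStarts σ i).map (cycleProd A σ)).prod

/-- The `j`th column determinant: in each monomial the cycles are multiplied from right to left
in the order `cycleStarts σ j`, so that the cycle through `j` comes last and the last factor of
the monomial is its entry in the `j`th column. -/
noncomputable def cdet {R : Type*} [Ring R] (j : Fin n) (A : Matrix (Fin n) (Fin n) R) : R :=
  ∑ σ : Perm (Fin n),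
    ((Perm.sign σ : ℤ) : R) * ((cycleStarts σ j).reverse.map (cycleProd A σ)).prod

/-- The determinant of a Hermitian quaternion matrix, as its first row determinant. (All row and
column determinants of a Hermitian matrix coincide.) -/
noncomputable def hermDet [NeZero n] (A : Matrix (Fin n) (Fin n) (Quaternion ℝ)) :
    Quaternion ℝ :=
  rdet 0 A

/-- The double determinant of a square quaternion matrix `A`: the determinant of the Hermitian
matrix `A A*`. -/
noncomputable def ddet [NeZero n] (A : Matrix (Fin n) (Fin n) (Quaternion ℝ)) : Quaternion ℝ :=
  hermDet (A * A.conjTranspose)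

end RowColDet

/-! For Hermitian `H`, inverting one cycle of `σ` preserves its sign and its cycle partition and
conjugates one cycle product. Averaging over such inversions replaces every cycle product by its
real part (`sum_sign_mul_prod_eq_sum_re`); real numbers commute, so all row and column determinants
of `H` agree. In the 2 × 2 complex representation a real part is half a trace, so the common value
is `spinDet X`, where `X` is the complex matrix of `H`.

With `J` the standard symplectic matrix, `X * J` is skew and `spinDet X` is its Pfaffian
(`pf_eq_spinDet`): a perfect matching superposed on the standard one forms even cycles, and
orienting these cycles gives a permutation `σ`; with `r` cycles there are `2 ^ r` orientations,
whence the weight `2 ^ (-r)`. The rule `pf (B W Bᵀ) = det B * pf W` then shows that the determinant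
of `A A*` is the complex determinant of `A`. This is multiplicative, and being real it is the same
for `A*`. -/

namespace RowColDet

open Equiv

variable {n : ℕ}

/-! ### Pfaffians under congruence -/

section Pfaffian

variable {ι R : Type*} [Fintype ι] [DecidableEq ι] [CommRing R]

/-- The term of a permutation in the Pfaffian of a matrix indexed by `ι × Bool`. -/
def pfTerm (W : Matrix (ι × Bool) (ι × Bool) R) (τ : Perm (ι × Bool)) : R :=
  ((Perm.sign τ : ℤ) : R) * ∏ k, W (τ (k, false)) (τ (k, true))

/-- The Pfaffian of a matrix indexed by `ι × Bool`, multiplied by `2 ^ n * n!`, where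
`n = card ι`. -/
def pf (W : Matrix (ι × Bool) (ι × Bool) R) : R :=
  ∑ τ, pfTerm W τ

theorem sum_sign_mul_prod_eq_zero {X : Type*} [Fintype X] [DecidableEq X] (B : Matrix X X R)
    {g : X → X} (hg : ¬ Function.Bijective g) :
    ∑ τ : Perm X, ((Perm.sign τ : ℤ) : R) * ∏ x, B (τ x) (g x) = 0 := by
  rw [← Finite.injective_iff_bijective, Function.Injective] at hg
  push Not at hg
  obtain ⟨i, j, hij, hne⟩ := hg
  rw [← Matrix.det_zero_of_column_eq (M := B.submatrix id g) hne (by simp [hij]),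
    Matrix.det_apply']
  rfl

theorem sum_sign_mul_prod_perm {X : Type*} [Fintype X] [DecidableEq X] (B : Matrix X X R)
    (g : Perm X) :
    ∑ τ : Perm X, ((Perm.sign τ : ℤ) : R) * ∏ x, B (τ x) (g x) =
      ((Perm.sign g : ℤ) : R) * B.det := by
  rw [← Matrix.det_permute', Matrix.det_apply']
  rfl

/-- Expanding the entries gives a sum over maps `g`, in which the inner sum over `τ` is the
determinant of the columns of `B` selected by `g`. It vanishes unless `g` is a permutation, and then
equals `sign g * det B`. -/
theorem pf_mul_mul_transpose (B W : Matrix (ι × Bool) (ι × Bool) R) :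
    pf (B * W * B.transpose) = B.det * pf W := by
  have key : ∀ τ : Perm (ι × Bool), pfTerm (B * W * B.transpose) τ =
      ∑ g : ι × Bool → ι × Bool, (∏ k, W (g (k, false)) (g (k, true))) *
        (((Perm.sign τ : ℤ) : R) * ∏ x, B (τ x) (g x)) := by
    intro τ
    have h1 : ∀ a b, (B * W * B.transpose) a b =
        ∑ c : Bool → ι × Bool, B a (c false) * W (c false) (c true) * B b (c true) := by
      intro a b
      rw [← (Equiv.boolArrowEquivProd _).symm.sum_comp, Fintype.sum_prod_type_right]
      simp [Matrix.mul_apply, Finset.sum_mul]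
    simp_rw [pfTerm, h1]
    rw [Finset.prod_univ_sum, Fintype.piFinset_univ, Finset.mul_sum,
      ← (Equiv.curry ι Bool (ι × Bool)).sum_comp]
    refine Finset.sum_congr rfl fun g _ => ?_
    rw [Fintype.prod_prod_type]
    simp only [Fintype.prod_bool, Finset.prod_mul_distrib, Equiv.curry_apply, Function.curry]
    ring
  rw [pf]
  simp_rw [key]
  rw [Finset.sum_comm]
  simp_rw [← Finset.mul_sum]
  rw [← Finset.sum_subset
    (s₁ := Finset.univ.filter fun g : ι × Bool → ι × Bool => Function.Bijective g)
    (Finset.subset_univ _), pf, Finset.mul_sum]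
  · refine Finset.sum_bij (fun g h => Equiv.ofBijective g (Finset.mem_filter.1 h).2)
      (fun _ _ => Finset.mem_univ _) (fun g _ g' _ h => by
        simpa using congrArg (fun e : Perm (ι × Bool) => (e : ι × Bool → ι × Bool)) h)
      (fun τ _ => ⟨τ, by simp, Equiv.ext fun _ => rfl⟩) fun g hg => ?_
    have := sum_sign_mul_prod_perm B (Equiv.ofBijective g (Finset.mem_filter.1 hg).2)
    simp only [Equiv.ofBijective_apply] at this
    rw [this, pfTerm]
    simp only [Equiv.ofBijective_apply]
    ring
  · intro g _ hg
    rw [sum_sign_mul_prod_eq_zero, mul_zero]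
    simpa using hg

end Pfaffian

/-! ### Orientations of superposed matchings -/

section Flips

variable {ι : Type*}

/-- The permutation of `ι × Bool` that flips the second component over `{k | s k = true}`. -/
def flipBy (s : ι → Bool) : Perm (ι × Bool) :=
  prodCongrRight fun k => if s k then Equiv.boolNot else 1

/-- The permutation of `ι × Bool` that acts as `π` on `ι × {false}` and as `ρ` on
`ι × {true}`. -/
def layered (π ρ : Perm ι) : Perm (ι × Bool) :=
  prodCongrLeft fun b => if b then ρ else π

@[simp]
theorem flipBy_apply (s : ι → Bool) (x : ι × Bool) : flipBy s x = (x.1, x.2 ^^ s x.1) := by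
  obtain ⟨k, b⟩ := x
  cases h : s k <;> simp [flipBy, h]

theorem flipBy_mul_self (s : ι → Bool) : flipBy s * flipBy s = 1 := by
  ext x <;> simp

@[simp]
theorem layered_apply_false (π ρ : Perm ι) (k : ι) : layered π ρ (k, false) = (π k, false) := rfl

@[simp]
theorem layered_apply_true (π ρ : Perm ι) (k : ι) : layered π ρ (k, true) = (ρ k, true) := rfl

theorem layered_mul (π ρ π' ρ' : Perm ι) :
    layered π ρ * layered π' ρ' = layered (π * π') (ρ * ρ') := by
  ext ⟨k, b⟩ <;> cases b <;> simp

theorem layered_injective :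
    Function.Injective fun p : Perm ι × Perm ι => layered p.1 p.2 := by
  rintro ⟨π, ρ⟩ ⟨π', ρ'⟩ h
  have h' := fun x => congrArg (fun e : Perm (ι × Bool) => e x) h
  refine Prod.ext (Equiv.ext fun k => ?_) (Equiv.ext fun k => ?_)
  · simpa using h' (k, false)
  · simpa using h' (k, true)

theorem exists_eq_layered {τ : Perm (ι × Bool)} (h : ∀ x, (τ x).2 = x.2) :
    ∃ π ρ, τ = layered π ρ := by
  have h' : ∀ x, (τ.symm x).2 = x.2 := fun x => by simpa [eq_comm] using h (τ.symm x)
  have e : ∀ b k, ((τ (k, b)).1, b) = τ (k, b) := fun b k => Prod.ext rfl (h (k, b)).symm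
  have e' : ∀ b k, ((τ.symm (k, b)).1, b) = τ.symm (k, b) :=
    fun b k => Prod.ext rfl (h' (k, b)).symm
  let f (b : Bool) : Perm ι := ⟨fun k => (τ (k, b)).1, fun k => (τ.symm (k, b)).1,
    fun k => by simp [e], fun k => by simp [e']⟩
  refine ⟨f false, f true, Equiv.ext ?_⟩
  rintro ⟨k, _ | _⟩
  · simp [f, e]
  · simp [f, e]

section Sign

variable [Fintype ι] [DecidableEq ι]

theorem sign_flipBy (s : ι → Bool) :
    Perm.sign (flipBy s) = ∏ k, if s k then -1 else 1 := by
  rw [flipBy, Perm.sign_prodCongrRight]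
  refine Finset.prod_congr rfl fun k _ => ?_
  have h : Perm.sign Equiv.boolNot = -1 := by decide
  split_ifs
  · exact h
  · exact Perm.sign_one

theorem sign_layered (π ρ : Perm ι) :
    Perm.sign (layered π ρ) = Perm.sign π * Perm.sign ρ := by
  rw [layered, Perm.sign_prodCongrLeft, Fintype.prod_bool, mul_comm]
  simp

end Sign

/-- An involution without fixed points on a type with another such involution admits a
two-colouring that both involutions reverse. -/
theorem exists_two_colouring {X : Type*} (μ ν : Perm X) (hμ : μ * μ = 1) (hν : ν * ν = 1)
    (hμ' : ∀ x, μ x ≠ x) (hν' : ∀ x, ν x ≠ x) :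
    ∃ f : X → Bool, (∀ x, f (μ x) = !f x) ∧ ∀ x, f (ν x) = !f x := by
  classical
  have mm : ∀ x, μ (μ x) = x := fun x => by rw [← Perm.mul_apply, hμ, Perm.one_apply]
  have nn : ∀ x, ν (ν x) = x := fun x => by rw [← Perm.mul_apply, hν, Perm.one_apply]
  set ρ := μ * ν with hρ
  have hinv : ν * ρ * ν⁻¹ = ρ⁻¹ := by
    rw [hρ, mul_inv_rev, mul_assoc, mul_assoc, mul_inv_cancel, mul_one,
      inv_eq_of_mul_eq_one_right hν, inv_eq_of_mul_eq_one_right hμ]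
  have hpow : ∀ (k : ℤ) x, ν ((ρ ^ k) x) = (ρ ^ (-k)) (ν x) := by
    intro k x
    rw [zpow_neg, ← inv_zpow, ← hinv, conj_zpow]
    simp
  -- If `ν x = ρ ^ k x`, then `ν` fixes `ρ ^ j x` when `k = 2 * j`, and `μ` fixes `ρ ^ (-j) (ν x)`
  -- when `k = 2 * j + 1`.
  have hne : ∀ x, ¬ ρ.SameCycle x (ν x) := by
    rintro x ⟨k, hk⟩
    obtain ⟨j, rfl | rfl⟩ := Int.even_or_odd' k
    · refine hν' ((ρ ^ j) x) ?_
      rw [hpow, ← hk, ← Perm.mul_apply, ← zpow_add]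
      congr 2
      ring
    · refine hμ' ((ρ ^ (-j)) (ν x)) ?_
      have : (ρ ^ (-j)) (ν x) = (ρ ^ (j + 1)) x := by
        rw [← hk, ← Perm.mul_apply, ← zpow_add]
        congr 2
        ring
      conv_lhs => rw [← hpow]
      rw [this, add_comm, zpow_add, zpow_one, Perm.mul_apply, hρ, Perm.mul_apply]
  let S := Perm.SameCycle.setoid ρ
  let q : X → X := fun x => (Quotient.mk S x).out
  have hq : ∀ x y, q x = q y ↔ ρ.SameCycle x y := by
    intro x y
    rw [Quotient.out_inj]
    exact Quotient.eq
  -- The colour of `x` compares the representatives of the `ρ`-cycles of `x` and `ν x`. Applying `ν`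
  -- exchanges these two distinct cycles, and `μ x = ρ (ν x)` lies in the cycle of `ν x`.
  let : LinearOrder X := linearOrderOfSTO WellOrderingRel
  have hνρ : ∀ x y, ρ.SameCycle x y → ρ.SameCycle (ν x) (ν y) := by
    rintro x _ ⟨k, rfl⟩
    exact ⟨-k, (hpow k x).symm⟩
  have hf : ∀ x, decide (q (ν x) < q (ν (ν x))) = !decide (q x < q (ν x)) := by
    intro x
    have hne' : q x ≠ q (ν x) := fun h => hne x ((hq _ _).1 h)
    rw [nn, ← decide_not, decide_eq_decide, not_lt]
    exact ⟨le_of_lt, fun h => lt_of_le_of_ne h hne'.symm⟩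
  refine ⟨fun x => decide (q x < q (ν x)), fun x => ?_, hf⟩
  have h1 : ρ.SameCycle (ν x) (μ x) := ⟨1, by simp [hρ, nn]⟩
  have h2 : q (ν x) = q (μ x) := (hq _ _).2 h1
  have h3 : q (ν (ν x)) = q (ν (μ x)) := (hq _ _).2 (hνρ _ _ h1)
  rw [← hf x, h2, h3]

variable [Fintype ι] [DecidableEq ι]

/-- The pairs `(s, e)` such that `flipBy s * τ * flipBy e` preserves the second component. -/
def orientations (τ : Perm (ι × Bool)) : Finset ((ι → Bool) × (ι → Bool)) :=
  Finset.univ.filter fun p => ∀ x, ((τ x).2 ^^ p.1 (τ x).1) = (x.2 ^^ p.2 x.1)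

theorem mem_orientations {τ : Perm (ι × Bool)} {s e : ι → Bool} :
    (s, e) ∈ orientations τ ↔ ∀ x, ((τ x).2 ^^ s (τ x).1) = (x.2 ^^ e x.1) := by
  simp [orientations]

/-- An orientation is a two-colouring reversed by the standard matching `ν` and by its conjugate
under `τ`. Here `s` records the colouring on the `false` layer and `e` its pullback along `τ`. -/
theorem orientations_nonempty (τ : Perm (ι × Bool)) : (orientations τ).Nonempty := by
  let ν : Perm (ι × Bool) := flipBy fun _ => true
  have hν : ν * ν = 1 := flipBy_mul_self _
  have hν' : ∀ x, ν x ≠ x := fun x h => by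
    have := congrArg Prod.snd h
    simp [ν] at this
  obtain ⟨f, hf, hf'⟩ := exists_two_colouring (τ * ν * τ⁻¹) ν
    (by rw [mul_assoc, mul_assoc, mul_assoc, inv_mul_cancel_left, ← mul_assoc ν, hν, one_mul,
      mul_inv_cancel]) hν (fun x h => hν' (τ⁻¹ x) (by
        rw [Perm.mul_apply, Perm.mul_apply] at h
        rw [Perm.eq_inv_iff_eq, h])) hν'
  have h1 : ∀ x : ι × Bool, f x = (x.2 ^^ f (x.1, false)) := by
    rintro ⟨k, _ | _⟩
    · simp
    · simpa [ν] using hf' (k, false)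
  refine ⟨(fun k => f (k, false), fun k => f (τ (k, false))), mem_orientations.2 fun x => ?_⟩
  rw [← h1]
  obtain ⟨k, _ | _⟩ := x
  · simp
  · simpa [ν] using hf (τ (k, false))

theorem card_orientations_flipBy_mul (s e : ι → Bool) (τ : Perm (ι × Bool)) :
    (orientations (flipBy s * τ * flipBy e)).card = (orientations τ).card := by
  have hx : ∀ s' e' : ι → Bool, (s', e') ∈ orientations (flipBy s * τ * flipBy e) ↔
      ((fun k => s k ^^ s' k), fun k => e k ^^ e' k) ∈ orientations τ := by
    intro s' e'
    rw [mem_orientations, mem_orientations, ← (flipBy e).forall_congr_right]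
    refine forall_congr' fun x => ?_
    have : flipBy e (flipBy e x) = x := by rw [← Perm.mul_apply, flipBy_mul_self]; rfl
    simp only [Perm.mul_apply, this]
    simp
  refine Finset.card_bij (fun p _ => ((fun k => s k ^^ p.1 k), fun k => e k ^^ p.2 k))
    (fun p hp => (hx _ _).1 hp) ?_ ?_
  · rintro ⟨a, b⟩ _ ⟨a', b'⟩ _ h
    simpa [funext_iff] using h
  · rintro ⟨a, b⟩ h
    exact ⟨((fun k => s k ^^ a k), fun k => e k ^^ b k), (hx _ _).2 (by simpa using h), by simp⟩

/-- The number of subsets invariant under a permutation. -/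
def invCount (σ : Perm ι) : ℕ :=
  (Finset.univ.filter fun g : ι → Bool => ∀ k, g (σ k) = g k).card

/-- The condition reads `s ∘ π = e = s ∘ ρ`, so `s` determines `e` and is invariant under `ρ * π⁻¹`.
-/
theorem card_orientations_layered (π ρ : Perm ι) :
    (orientations (layered π ρ)).card = invCount (ρ * π⁻¹) := by
  have hx : ∀ s e : ι → Bool, (s, e) ∈ orientations (layered π ρ) ↔
      (∀ k, s ((ρ * π⁻¹) k) = s k) ∧ e = fun k => s (π k) := by
    intro s e
    rw [mem_orientations, funext_iff, ← π.forall_congr_right (q := fun k => s ((ρ * π⁻¹) k) = s k)]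
    constructor
    · intro h
      have h0 : ∀ k, s (π k) = e k := fun k => by simpa using h (k, false)
      have h1 : ∀ k, s (ρ k) = e k := fun k => by simpa using h (k, true)
      exact ⟨fun k => by simp [h0, h1], fun k => (h0 k).symm⟩
    · rintro ⟨h1, h0⟩ ⟨k, _ | _⟩
      · simp [h0]
      · have := h1 k
        rw [Perm.mul_apply, Perm.inv_def, Equiv.symm_apply_apply] at this
        simp [h0, this]
  refine Finset.card_bij (fun p _ => p.1) (fun p hp => ?_) ?_ ?_
  · exact Finset.mem_filter.2 ⟨Finset.mem_univ _, ((hx _ _).1 hp).1⟩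
  · rintro ⟨a, b⟩ h ⟨a', b'⟩ h' rfl
    rw [((hx _ _).1 h).2, ((hx _ _).1 h').2]
  · intro g hg
    exact ⟨(g, fun k => g (π k)), (hx _ _).2 ⟨(Finset.mem_filter.1 hg).2, rfl⟩, rfl⟩

theorem sum_filter_mem_orientations {M : Type*} [AddCommMonoid M] (s e : ι → Bool)
    (F : Perm (ι × Bool) → M) :
    ∑ τ with (s, e) ∈ orientations τ, F τ =
      ∑ p : Perm ι × Perm ι, F (flipBy s * layered p.1 p.2 * flipBy e) := by
  have hs := flipBy_mul_self s
  have he := flipBy_mul_self e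
  symm
  refine Finset.sum_bij (fun p _ => flipBy s * layered p.1 p.2 * flipBy e) ?_ ?_ ?_
    fun _ _ => rfl
  · rintro ⟨π, ρ⟩ _
    simp only [Finset.mem_filter, Finset.mem_univ, true_and, mem_orientations]
    rintro ⟨k, b⟩
    cases b <;> cases h : e k <;> simp [h]
  · intro p _ p' _ h
    exact layered_injective (mul_left_cancel (mul_right_cancel h))
  · intro τ hτ
    simp only [Finset.mem_filter, Finset.mem_univ, true_and, mem_orientations] at hτ
    obtain ⟨π, ρ, h⟩ := exists_eq_layered (τ := flipBy s * τ * flipBy e) fun x => by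
      have := hτ (flipBy e x)
      simp only [flipBy_apply, Bool.xor_assoc, Bool.xor_self, Bool.xor_false] at this
      simp [this]
    refine ⟨(π, ρ), Finset.mem_univ _, ?_⟩
    rw [← h, mul_assoc, mul_assoc, mul_assoc, he, mul_one, ← mul_assoc, hs, one_mul]

end Flips

/-! ### The Pfaffian as a sum over permutations -/

section PfaffianSpin

variable {ι R : Type*} [Fintype ι] [DecidableEq ι] [CommRing R]
  {W : Matrix (ι × Bool) (ι × Bool) R}

/-- Each flip changes the sign of `τ` and swaps the arguments of one skew entry; the two signs
cancel. -/
theorem pfTerm_mul_flipBy (hW : W.transpose = -W) (τ : Perm (ι × Bool)) (e : ι → Bool) :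
    pfTerm W (τ * flipBy e) = pfTerm W τ := by
  have h : ∀ x y, W x y = -W y x := fun x y => by
    have := congrFun₂ hW y x
    simpa using this
  have h2 : ∀ k, W ((τ * flipBy e) (k, false)) ((τ * flipBy e) (k, true)) =
      (if e k then -1 else 1) * W (τ (k, false)) (τ (k, true)) := by
    intro k
    cases hk : e k
    · simp [hk]
    · simp [hk, ← h]
  have h3 : ((∏ k, if e k then (-1 : ℤˣ) else 1 : ℤˣ) : ℤ) * (∏ k, if e k then (-1 : ℤ) else 1)
      = 1 := by
    rw [Units.coe_prod, ← Finset.prod_mul_distrib]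
    exact Finset.prod_eq_one fun k _ => by split_ifs <;> simp
  have h4 : (∏ k, if e k then (-1 : R) else 1) = ((∏ k, if e k then (-1 : ℤ) else 1 : ℤ) : R) := by
    push_cast
    exact Finset.prod_congr rfl fun k _ => by split_ifs <;> simp
  simp_rw [pfTerm, h2, Finset.prod_mul_distrib, Perm.sign_mul, sign_flipBy, h4]
  calc _ = ((Perm.sign τ : ℤ) : R) * ((((∏ k, if e k then (-1 : ℤˣ) else 1 : ℤˣ) : ℤ) *
        (∏ k, if e k then (-1 : ℤ) else 1) : ℤ) : R) * ∏ k, W (τ (k, false)) (τ (k, true)) := by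
        push_cast; ring
    _ = _ := by rw [h3]; simp

theorem pfTerm_mul_layered_self (τ : Perm (ι × Bool)) (π : Perm ι) :
    pfTerm W (τ * layered π π) = pfTerm W τ := by
  simp only [pfTerm, Perm.sign_mul, sign_layered, Int.units_mul_self, mul_one, Perm.mul_apply,
    layered_apply_false, layered_apply_true]
  rw [Equiv.prod_comp π fun k => W (τ (k, false)) (τ (k, true))]

/-- The determinant-like sum in which a permutation is weighted by its sign and the inverse of
its number of invariant subsets, for a matrix of two-by-two blocks. -/
def spinDet {K : Type*} [Field K] (Y : Matrix (ι × Bool) (ι × Bool) K) : K :=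
  ∑ σ : Perm ι, ((Perm.sign σ : ℤ) : K) * (invCount σ : K)⁻¹ *
    ∑ s : ι → Bool, ∏ k, Y (k, s k) (σ k, s (σ k))

/-- The column signs in `hY` occur at the indices `σ k`; their product over all `k` cancels the sign
of `flipBy s`. -/
theorem pfTerm_flipBy_mul_layered_one {Y : Matrix (ι × Bool) (ι × Bool) R}
    (hY : ∀ x k b, W x (k, b) = (if b then 1 else -1) * Y x (k, !b)) (s : ι → Bool) (σ : Perm ι) :
    pfTerm W (flipBy s * layered 1 σ) =
      ((Perm.sign σ : ℤ) : R) * ∏ k, Y (k, s k) (σ k, s (σ k)) := by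
  have h1 : ∀ k, W ((flipBy s * layered 1 σ) (k, false)) ((flipBy s * layered 1 σ) (k, true)) =
      (if s (σ k) then -1 else 1) * Y (k, s k) (σ k, s (σ k)) := by
    intro k
    cases h : s (σ k) <;> simp [h, hY]
  have h2 : ((∏ k, if s k then (-1 : ℤˣ) else 1 : ℤˣ) : ℤ) * (∏ k, if s k then (-1 : ℤ) else 1)
      = 1 := by
    rw [Units.coe_prod, ← Finset.prod_mul_distrib]
    exact Finset.prod_eq_one fun k _ => by split_ifs <;> simp
  have h3 : (∏ k, if s (σ k) then (-1 : R) else 1) =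
      ((∏ k, if s k then (-1 : ℤ) else 1 : ℤ) : R) := by
    rw [Equiv.prod_comp σ fun k => if s k then (-1 : R) else 1]
    push_cast
    exact Finset.prod_congr rfl fun k _ => by split_ifs <;> simp
  simp_rw [pfTerm, h1, Finset.prod_mul_distrib, Perm.sign_mul, sign_flipBy, sign_layered, h3]
  calc _ = ((Perm.sign σ : ℤ) : R) * ((((∏ k, if s k then (-1 : ℤˣ) else 1 : ℤˣ) : ℤ) *
        (∏ k, if s k then (-1 : ℤ) else 1) : ℤ) : R) *
        ∏ k, Y (k, s k) (σ k, s (σ k)) := by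
        push_cast; simp; ring
    _ = _ := by rw [h2]; simp

theorem pf_eq_spinDet {K : Type*} [Field K] [CharZero K]
    {W Y : Matrix (ι × Bool) (ι × Bool) K} (hW : W.transpose = -W)
    (hY : ∀ x k b, W x (k, b) = (if b then 1 else -1) * Y x (k, !b)) :
    pf W = (Fintype.card ((ι → Bool) × Perm ι) : K) * spinDet Y := by
  -- Each term is averaged over its orientations, of which there is at least one.
  have h1 : ∀ τ, pfTerm W τ =
      ∑ p with p ∈ orientations τ, ((orientations τ).card : K)⁻¹ * pfTerm W τ := by
    intro τ
    have : ((orientations τ).card : K) ≠ 0 :=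
      Nat.cast_ne_zero.2 (Finset.card_ne_zero.2 (orientations_nonempty τ))
    rw [Finset.filter_mem_eq_inter, Finset.univ_inter, Finset.sum_const, nsmul_eq_mul,
      mul_inv_cancel_left₀ this]
  -- Only `s` and `ρ * π⁻¹` matter, so the free sums over `e` and `π` produce the cardinality
  -- factor.
  have h2 : ∀ (s e : ι → Bool) (π ρ : Perm ι),
      ((orientations (flipBy s * layered π ρ * flipBy e)).card : K)⁻¹ *
        pfTerm W (flipBy s * layered π ρ * flipBy e) =
      (invCount (ρ * π⁻¹) : K)⁻¹ * pfTerm W (flipBy s * layered 1 (ρ * π⁻¹)) := by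
    intro s e π ρ
    have : layered π ρ = layered 1 (ρ * π⁻¹) * layered π π := by simp [layered_mul]
    rw [card_orientations_flipBy_mul, card_orientations_layered, pfTerm_mul_flipBy hW, this,
      ← mul_assoc, pfTerm_mul_layered_self]
  calc pf W = ∑ τ, ∑ p with p ∈ orientations τ,
        ((orientations τ).card : K)⁻¹ * pfTerm W τ := Finset.sum_congr rfl fun τ _ => h1 τ
    _ = ∑ p : (ι → Bool) × (ι → Bool), ∑ τ with p ∈ orientations τ,
        ((orientations τ).card : K)⁻¹ * pfTerm W τ := by
      simp_rw [Finset.sum_filter]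
      exact Finset.sum_comm
    _ = ∑ e : ι → Bool, ∑ π : Perm ι, ∑ s : ι → Bool, ∑ σ : Perm ι,
        (invCount σ : K)⁻¹ * pfTerm W (flipBy s * layered 1 σ) := by
      rw [Fintype.sum_prod_type_right]
      refine Finset.sum_congr rfl fun e _ => ?_
      simp_rw [sum_filter_mem_orientations, h2, Fintype.sum_prod_type]
      rw [Finset.sum_comm]
      refine Finset.sum_congr rfl fun π _ => Finset.sum_congr rfl fun s _ => ?_
      exact Equiv.sum_comp (Equiv.mulRight π⁻¹) fun σ =>
        (invCount σ : K)⁻¹ * pfTerm W (flipBy s * layered 1 σ)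
    _ = _ := by
      simp_rw [pfTerm_flipBy_mul_layered_one hY]
      rw [spinDet, Finset.sum_const, Finset.sum_const, Finset.sum_comm, nsmul_eq_mul,
        nsmul_eq_mul, ← mul_assoc, Finset.card_univ, Finset.card_univ, Fintype.card_prod,
        Nat.cast_mul]
      simp_rw [Finset.mul_sum]
      refine Finset.sum_congr rfl fun σ _ => Finset.sum_congr rfl fun s _ => ?_
      ring

end PfaffianSpin

/-! ### Traces as sums over closed words -/

section CyclicWords

variable {β R : Type*} [Fintype β] [DecidableEq β] [CommRing R]

theorem list_prod_map_range_apply (x : ℕ → Matrix β β R) (m : ℕ) (a b : β) :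
    ((List.range m).map x).prod a b = ∑ s : Fin (m + 1) → β,
      if s 0 = a ∧ s (Fin.last m) = b then ∏ k : Fin m, x k (s k.castSucc) (s k.succ) else 0 := by
  induction m generalizing b with
  | zero =>
    rw [← (Equiv.funUnique (Fin 1) β).symm.sum_comp]
    simp [Matrix.one_apply, ite_and]
  | succ m ih =>
    rw [List.range_succ, List.map_append, List.prod_append, Matrix.mul_apply,
      ← (Fin.snocEquiv fun _ => β).sum_comp, Fintype.sum_prod_type_right]
    simp_rw [ih, Finset.sum_mul]
    rw [Finset.sum_comm]
    refine Finset.sum_congr rfl fun s _ => ?_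
    have h0 : ∀ c : β, (Fin.snocEquiv (fun _ : Fin (m + 2) => β)) (c, s) 0 = s 0 := fun c =>
      Fin.snoc_castSucc (α := fun _ => β) c s 0
    have h1 : ∀ c : β, (Fin.snocEquiv (fun _ : Fin (m + 2) => β)) (c, s) (Fin.last _) = c :=
      fun c => Fin.snoc_last (α := fun _ => β) c s
    have h2 : ∀ (c : β) k, (Fin.snocEquiv (fun _ : Fin (m + 2) => β)) (c, s) (Fin.castSucc k) =
      s k := fun c k => Fin.snoc_castSucc (α := fun _ => β) c s k
    simp_rw [Fin.prod_univ_castSucc, h0, h1, ← Fin.castSucc_succ, h2, Fin.succ_last, h1, ite_and]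
    by_cases ha : s 0 = a <;> simp [ha]

/-- Addition in `Fin m` wraps around, so `k + 1` closes the word. -/
theorem trace_list_prod_map_range (x : ℕ → Matrix β β R) (m : ℕ) [NeZero m] :
    (((List.range m).map x).prod).trace =
      ∑ s : Fin m → β, ∏ k : Fin m, x k (s k) (s (k + 1)) := by
  cases m with
  | zero => exact absurd rfl (NeZero.ne 0)
  | succ m =>
    rw [List.range_succ, List.map_append, List.prod_append, Matrix.trace]
    simp_rw [Matrix.diag_apply, Matrix.mul_apply, list_prod_map_range_apply, Finset.sum_mul]
    simp_rw [fun a => Finset.sum_comm (s := (Finset.univ : Finset β))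
      (t := (Finset.univ : Finset (Fin (m + 1) → β)))
      (f := fun c s => (if s 0 = a ∧ s (Fin.last m) = c then
        ∏ k : Fin m, x k (s k.castSucc) (s k.succ) else 0) * (List.map x [m]).prod c a)]
    rw [Finset.sum_comm]
    refine Finset.sum_congr rfl fun s _ => ?_
    simp [ite_and, Fin.prod_univ_castSucc]

end CyclicWords

/-! ### Cycle representatives and factorisation over cycles -/

section Starts

open Function (minimalPeriod)

theorem minimalPeriod_perm_pos (σ : Perm (Fin n)) (i : Fin n) : 0 < minimalPeriod σ i :=
  Function.minimalPeriod_pos_of_mem_periodicPts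
    (Function.Injective.mem_periodicPts σ.injective i)

theorem pow_mod_minimalPeriod (σ : Perm (Fin n)) (i : Fin n) (k : ℕ) :
    (σ ^ (k % minimalPeriod σ i)) i = (σ ^ k) i := by
  simpa only [Perm.iterate_eq_pow] using Function.iterate_mod_minimalPeriod_eq (f := σ) (x := i)

theorem pow_minimalPeriod (σ : Perm (Fin n)) (i : Fin n) :
    (σ ^ minimalPeriod σ i) i = i := by
  simpa only [Perm.iterate_eq_pow] using Function.iterate_minimalPeriod (f := σ) (x := i)

/-- A list of representatives of the cycles of a permutation, one for each cycle. -/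
structure IsCycleReps (σ : Perm (Fin n)) (L : List (Fin n)) : Prop where
  nodup : L.Nodup
  eq_of_sameCycle : ∀ {j k}, j ∈ L → k ∈ L → σ.SameCycle j k → j = k
  exists_sameCycle : ∀ x, ∃ j ∈ L, σ.SameCycle j x

theorem isCycleReps_cycleStarts (σ : Perm (Fin n)) (i : Fin n) :
    IsCycleReps σ (cycleStarts σ i) where
  nodup := by
    refine List.nodup_cons.2 ⟨fun h => ?_, (List.nodup_finRange n).filter _⟩
    have h' := (List.mem_filter.1 h).2
    rw [decide_eq_true_eq] at h'
    exact h'.1 (Perm.SameCycle.refl σ i)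
  eq_of_sameCycle := by
    intro j k hj hk h
    simp only [cycleStarts, List.mem_cons, List.mem_filter, List.mem_finRange, true_and,
      decide_eq_true_eq] at hj hk
    rcases hj with rfl | hj <;> rcases hk with rfl | hk
    · rfl
    · exact absurd h hk.1
    · exact absurd h.symm hj.1
    · exact le_antisymm (hj.2 _ h) (hk.2 _ h.symm)
  exists_sameCycle := by
    intro x
    by_cases hx : σ.SameCycle i x
    · exact ⟨i, List.mem_cons_self, hx⟩
    · obtain ⟨j, hj, hmin⟩ := Finset.exists_min_image
        (Finset.univ.filter fun j => σ.SameCycle x j) id ⟨x, by simp [Perm.SameCycle.refl]⟩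
      simp only [Finset.mem_filter, Finset.mem_univ, true_and, id] at hj hmin
      refine ⟨j, List.mem_cons_of_mem _ ?_, hj.symm⟩
      simp only [List.mem_filter, List.mem_finRange, true_and, decide_eq_true_eq]
      exact ⟨fun h => hx (h.trans hj.symm), fun k hk => hmin k (hj.trans hk)⟩

variable {σ : Perm (Fin n)} {L : List (Fin n)}

theorem IsCycleReps.bijective (h : IsCycleReps σ L) :
    Function.Bijective fun p : (Σ j : {j // j ∈ L.toFinset}, Fin (minimalPeriod σ j)) =>
      (σ ^ (p.2 : ℕ)) p.1 := by
  constructor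
  · rintro ⟨⟨j, hj⟩, k⟩ ⟨⟨j', hj'⟩, k'⟩ hp
    simp only at hp
    have hjj : j = j' := by
      refine h.eq_of_sameCycle (List.mem_toFinset.1 hj) (List.mem_toFinset.1 hj') ?_
      rw [← Perm.sameCycle_pow_right (n := (k' : ℕ)), ← hp]
      exact ⟨(k : ℕ), by simp⟩
    subst hjj
    simp only [Sigma.mk.injEq, heq_eq_eq, true_and]
    refine Fin.ext ?_
    rw [← Perm.iterate_eq_pow, ← Perm.iterate_eq_pow] at hp
    exact (Function.iterate_eq_iterate_iff_of_lt_minimalPeriod k.2 k'.2).1 hp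
  · intro x
    obtain ⟨j, hj, hx⟩ := h.exists_sameCycle x
    obtain ⟨k, hk⟩ := hx.exists_nat_pow_eq
    exact ⟨⟨⟨j, List.mem_toFinset.2 hj⟩, ⟨k % minimalPeriod σ j,
      Nat.mod_lt _ (minimalPeriod_perm_pos σ j)⟩⟩, by simp [pow_mod_minimalPeriod, hk]⟩

variable {β R : Type*} [Fintype β] [DecidableEq β] [CommRing R]

/-- The sum over all colourings of the products of matrix entries along a permutation is a
product of traces over its cycles. -/
theorem IsCycleReps.sum_prod_eq (h : IsCycleReps σ L) (x : Fin n → Matrix β β R) :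
    ∑ s : Fin n → β, ∏ k, x k (s k) (s (σ k)) =
      (L.map fun j => (((List.range (minimalPeriod σ j)).map
        fun k => x ((σ ^ k) j)).prod).trace).prod := by
  have (j : Fin n) : NeZero (minimalPeriod σ j) := ⟨(minimalPeriod_perm_pos σ j).ne'⟩
  let f := Equiv.ofBijective _ h.bijective
  have hf : ∀ (j : {j // j ∈ L.toFinset}) (k : Fin (minimalPeriod σ j)),
      f ⟨j, k⟩ = (σ ^ (k : ℕ)) j := fun _ _ => rfl
  -- In the coordinates (representative, position), `σ` adds one to the position modulo the period.
  have hσf : ∀ (j : {j // j ∈ L.toFinset}) (k : Fin (minimalPeriod σ j)),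
      σ (f ⟨j, k⟩) = f ⟨j, k + 1⟩ := by
    intro j k
    rw [hf, hf, Fin.val_add, Fin.val_one', Nat.add_mod_mod, pow_mod_minimalPeriod, pow_succ',
      Perm.mul_apply]
  -- A colouring of `Fin n` is an independent choice of colouring on each cycle, so the sum factors.
  rw [← (Equiv.arrowCongr f (Equiv.refl β)).sum_comp, ← (Equiv.piCurry fun _ _ => β).symm.sum_comp]
  have h1 : ∀ c : (j : {j // j ∈ L.toFinset}) → Fin (minimalPeriod σ j) → β,
      ∏ k, x k (((Equiv.arrowCongr f (Equiv.refl β)) ((Equiv.piCurry fun _ _ => β).symm c)) k)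
        (((Equiv.arrowCongr f (Equiv.refl β)) ((Equiv.piCurry fun _ _ => β).symm c)) (σ k)) =
      ∏ j : {j // j ∈ L.toFinset}, ∏ k : Fin (minimalPeriod σ j),
        x ((σ ^ (k : ℕ)) j) (c j k) (c j (k + 1)) := by
    intro c
    rw [← f.prod_comp, Fintype.prod_sigma]
    refine Finset.prod_congr rfl fun j _ => Finset.prod_congr rfl fun k _ => ?_
    rw [hσf]
    simp only [Equiv.arrowCongr_apply, Function.comp_apply, Equiv.symm_apply_apply,
      Equiv.coe_refl, id]
    rw [hf]
    rfl
  simp_rw [h1]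
  rw [← List.prod_toFinset _ h.nodup, ← Finset.prod_coe_sort]
  simp_rw [trace_list_prod_map_range]
  rw [Finset.prod_univ_sum, Fintype.piFinset_univ]

/-- With identity matrices the colouring sum counts invariant subsets, and each cycle contributes a
trace of 2. -/
theorem IsCycleReps.two_pow_length (h : IsCycleReps σ L) :
    invCount σ = 2 ^ L.length := by
  have := h.sum_prod_eq (R := ℤ) (β := Bool) fun _ => 1
  have h1 : ∀ s : Fin n → Bool, (∏ k, (1 : Matrix Bool Bool ℤ) (s k) (s (σ k))) =
      if ∀ k, s (σ k) = s k then 1 else 0 := by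
    intro s
    simp_rw [Matrix.one_apply, Finset.prod_ite_zero, Finset.mem_univ, forall_const, eq_comm,
      Finset.prod_const_one]
  simp_rw [h1] at this
  rw [← Finset.natCast_card_filter] at this
  simp only [List.map_const', List.prod_replicate, one_pow, Matrix.trace_one,
    Fintype.card_bool] at this
  have h2 : (invCount σ : ℤ) = ((2 : ℕ) : ℤ) ^ L.length := by
    rw [← this, invCount]
    congr!
  exact_mod_cast h2

end Starts

/-! ### Inverting one cycle of a permutation -/

section FlipCycle

/-- The permutation obtained from `σ` by inverting its cycle through `m`. -/
def flipCycle (σ : Perm (Fin n)) (m : Fin n) : Perm (Fin n) :=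
  σ * (σ.cycleOf m)⁻¹ * (σ.cycleOf m)⁻¹

theorem sign_flipCycle (σ : Perm (Fin n)) (m : Fin n) :
    Perm.sign (flipCycle σ m) = Perm.sign σ := by
  rw [flipCycle, mul_assoc, Perm.sign_mul, Perm.sign_mul, Int.units_mul_self, mul_one]

theorem flipCycle_apply (σ : Perm (Fin n)) (m x : Fin n) :
    flipCycle σ m x = if σ.SameCycle m x then σ⁻¹ x else σ x := by
  by_cases h : σ.SameCycle m x
  · simp [flipCycle, Perm.cycleOf_inv, Perm.cycleOf_apply, h]
  · simp [flipCycle, Perm.cycleOf_inv, Perm.cycleOf_apply, h]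

theorem flipCycle_pow_apply_of_sameCycle {σ : Perm (Fin n)} {m x : Fin n}
    (h : σ.SameCycle m x) (k : ℕ) : (flipCycle σ m ^ k) x = (σ⁻¹ ^ k) x := by
  induction k with
  | zero => rfl
  | succ k ih =>
    rw [pow_succ', pow_succ', Perm.mul_apply, Perm.mul_apply, ih, flipCycle_apply, if_pos]
    rw [← Perm.sameCycle_inv] at h ⊢
    exact Perm.sameCycle_pow_right.2 h

theorem flipCycle_pow_apply_of_not_sameCycle {σ : Perm (Fin n)} {m x : Fin n}
    (h : ¬ σ.SameCycle m x) (k : ℕ) : (flipCycle σ m ^ k) x = (σ ^ k) x := by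
  induction k with
  | zero => rfl
  | succ k ih =>
    rw [pow_succ', pow_succ', Perm.mul_apply, Perm.mul_apply, ih, flipCycle_apply, if_neg]
    exact fun h' => h (Perm.sameCycle_pow_right.1 h')

theorem sameCycle_flipCycle (σ : Perm (Fin n)) (m x y : Fin n) :
    (flipCycle σ m).SameCycle x y ↔ σ.SameCycle x y := by
  by_cases h : σ.SameCycle m x
  · rw [← Perm.sameCycle_inv (f := σ)]
    constructor
    · intro h'
      obtain ⟨k, hk⟩ := h'.exists_nat_pow_eq
      exact ⟨k, by rw [zpow_natCast, ← flipCycle_pow_apply_of_sameCycle h, hk]⟩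
    · intro h'
      obtain ⟨k, hk⟩ := h'.exists_nat_pow_eq
      exact ⟨k, by rw [zpow_natCast, flipCycle_pow_apply_of_sameCycle h, hk]⟩
  · constructor
    · intro h'
      obtain ⟨k, hk⟩ := h'.exists_nat_pow_eq
      exact ⟨k, by rw [zpow_natCast, ← flipCycle_pow_apply_of_not_sameCycle h, hk]⟩
    · intro h'
      obtain ⟨k, hk⟩ := h'.exists_nat_pow_eq
      exact ⟨k, by rw [zpow_natCast, flipCycle_pow_apply_of_not_sameCycle h, hk]⟩

theorem flipCycle_flipCycle (σ : Perm (Fin n)) (m : Fin n) :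
    flipCycle (flipCycle σ m) m = σ := by
  ext1 x
  rw [flipCycle_apply]
  simp only [sameCycle_flipCycle]
  split_ifs with h
  · rw [Perm.inv_eq_iff_eq, flipCycle_apply, if_pos (Perm.sameCycle_apply_right.2 h),
      Perm.inv_def, Equiv.symm_apply_apply]
  · rw [flipCycle_apply, if_neg h]

end FlipCycle

/-! ### Cycle products under inversion -/

section CycleProd

variable {R : Type*} [Ring R]

open Function (minimalPeriod)

theorem minimalPeriod_congr {σ τ : Perm (Fin n)} {j : Fin n}
    (h : ∀ k : ℕ, (τ ^ k) j = (σ ^ k) j) : minimalPeriod τ j = minimalPeriod σ j := by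
  refine Function.minimalPeriod_eq_minimalPeriod_iff.2 fun k => ?_
  rw [Function.IsPeriodicPt, Function.IsPeriodicPt, Perm.iterate_eq_pow, Perm.iterate_eq_pow,
    Function.IsFixedPt, Function.IsFixedPt, h]

theorem cycleProd_congr (A : Matrix (Fin n) (Fin n) R) {σ τ : Perm (Fin n)} {j : Fin n}
    (h : ∀ k : ℕ, (τ ^ k) j = (σ ^ k) j) : cycleProd A τ j = cycleProd A σ j := by
  simp only [cycleProd, h, minimalPeriod_congr h]

theorem star_list_prod_eq [StarRing R] (l : List R) :
    star l.prod = (l.reverse.map star).prod := by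
  induction l with
  | nil => simp
  | cons a l ih => simp [ih]

/-- Reading the cycle backwards reverses the order of the factors and, as `A` is Hermitian,
conjugates each one. -/
theorem cycleProd_inv [StarRing R] {A : Matrix (Fin n) (Fin n) R} (hA : A.IsHermitian)
    (σ : Perm (Fin n)) (j : Fin n) : cycleProd A σ⁻¹ j = star (cycleProd A σ j) := by
  have hp : minimalPeriod (σ⁻¹ : Perm (Fin n)) j = minimalPeriod σ j := by
    refine Function.minimalPeriod_eq_minimalPeriod_iff.2 fun k => ?_
    rw [Function.IsPeriodicPt, Function.IsPeriodicPt, Perm.iterate_eq_pow, Perm.iterate_eq_pow,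
      Function.IsFixedPt, Function.IsFixedPt, inv_pow, Perm.inv_eq_iff_eq, eq_comm]
  have hk : ∀ k ≤ minimalPeriod σ j, (σ⁻¹ ^ k) j = (σ ^ (minimalPeriod σ j - k)) j := by
    intro k hk
    rw [inv_pow, Perm.inv_eq_iff_eq, ← Perm.mul_apply, ← pow_add, Nat.add_sub_cancel' hk,
      pow_minimalPeriod]
  rw [cycleProd, cycleProd, hp, star_list_prod_eq, ← List.map_reverse,
    List.range_eq_range', List.reverse_range', ← List.range_eq_range', List.map_map, List.map_map]
  congr 1
  refine List.map_congr_left fun k h => ?_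
  have h' := List.mem_range.1 h
  rw [hk k h'.le, hk (k + 1) h']
  have e1 : 0 + minimalPeriod σ j - 1 - k = minimalPeriod σ j - (k + 1) := by omega
  have e2 : minimalPeriod σ j - (k + 1) + 1 = minimalPeriod σ j - k := by omega
  simp only [Function.comp_apply, hA.apply, e1, e2]

end CycleProd

/-! ### Reduction to real parts -/

section Hermitian

open Quaternion

variable {H : Matrix (Fin n) (Fin n) ℍ[ℝ]}

/-- Leaving `L` general covers both the row and the column order. By `hL'` it survives the inversion
of a cycle. -/
theorem sum_sign_mul_prod_eq_sum_re (hH : H.IsHermitian) (L : Perm (Fin n) → List (Fin n))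
    (hL : ∀ σ, IsCycleReps σ (L σ))
    (hL' : ∀ σ τ, (∀ x y, τ.SameCycle x y ↔ σ.SameCycle x y) → L τ = L σ) :
    ∑ σ, ((Perm.sign σ : ℤ) : ℍ[ℝ]) * ((L σ).map (cycleProd H σ)).prod =
      ∑ σ, ((Perm.sign σ : ℤ) : ℍ[ℝ]) *
        ((L σ).map fun j => (((cycleProd H σ j).re : ℝ) : ℍ[ℝ])).prod := by
  -- The set `T` collects the representatives whose cycle products are already replaced by real
  -- parts.
  let x (T : Finset (Fin n)) (σ : Perm (Fin n)) (j : Fin n) : ℍ[ℝ] :=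
    if j ∈ T then (((cycleProd H σ j).re : ℝ) : ℍ[ℝ]) else cycleProd H σ j
  suffices key : ∀ T, ∑ σ, ((Perm.sign σ : ℤ) : ℍ[ℝ]) * ((L σ).map (cycleProd H σ)).prod =
      ∑ σ, ((Perm.sign σ : ℤ) : ℍ[ℝ]) * ((L σ).map (x T σ)).prod by
    simpa [x] using key Finset.univ
  intro T
  induction T using Finset.induction_on with
  | empty => simp [x]
  | insert m T hm ih =>
    rw [ih]
    have hLf : ∀ σ, L (flipCycle σ m) = L σ := fun σ => hL' _ _ (sameCycle_flipCycle σ m)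
    let φ (σ : Perm (Fin n)) : Perm (Fin n) := if m ∈ L σ then flipCycle σ m else σ
    have hφ : Function.Involutive φ := by
      intro σ
      by_cases h : m ∈ L σ <;> simp [φ, h, hLf, flipCycle_flipCycle]
    have h2 : (2 : ℍ[ℝ]) ≠ 0 := by
      rw [← one_add_one_eq_two]
      intro h
      simpa using congrArg QuaternionAlgebra.re h
    -- Doubling the sum and reindexing one copy by `φ` allows `φ` to have fixed points, among them
    -- the `σ` whose cycle through `m` has length at most two.
    refine mul_left_cancel₀ h2 ?_
    rw [two_mul]
    nth_rw 2 [← Equiv.sum_comp hφ.toPerm]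
    rw [← Finset.sum_add_distrib, Finset.mul_sum]
    refine Finset.sum_congr rfl fun σ _ => ?_
    rw [Function.Involutive.coe_toPerm]
    by_cases h : m ∈ L σ
    · simp only [φ, if_pos h, sign_flipCycle, hLf]
      obtain ⟨l₁, l₂, hl⟩ := List.append_of_mem h
      have hnd := (hL σ).nodup
      have hoff : ∀ j ∈ L σ, j ≠ m → x T (flipCycle σ m) j = x T σ j := by
        intro j hj hjm
        have : cycleProd H (flipCycle σ m) j = cycleProd H σ j :=
          cycleProd_congr H fun k => flipCycle_pow_apply_of_not_sameCycle
            (fun h' => hjm ((hL σ).eq_of_sameCycle h hj h').symm) k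
        simp only [x, this]
      have hoff' : ∀ j, j ≠ m → x (insert m T) σ j = x T σ j := by
        intro j hj
        simp [x, hj]
      have hm1 : x T (flipCycle σ m) m = star (x T σ m) := by
        simp only [x, if_neg hm]
        rw [← cycleProd_inv hH]
        exact cycleProd_congr H fun k =>
          flipCycle_pow_apply_of_sameCycle (Perm.SameCycle.refl σ m) k
      have hm2 : x T σ m + star (x T σ m) = 2 * x (insert m T) σ m := by
        simp [x, hm, Quaternion.self_add_star]
      rw [hl] at hnd hoff ⊢
      have hn1 : ∀ j ∈ l₁, j ≠ m := by
        rintro j hj rfl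
        exact (List.nodup_append.1 hnd).2.2 _ hj _ List.mem_cons_self rfl
      have hn2 : ∀ j ∈ l₂, j ≠ m := by
        rintro j hj rfl
        exact (List.nodup_cons.1 (List.nodup_append.1 hnd).2.1).1 hj
      have e1 : l₁.map (x T (flipCycle σ m)) = l₁.map (x T σ) :=
        List.map_congr_left fun j hj => hoff j (by simp [hj]) (hn1 j hj)
      have e2 : l₂.map (x T (flipCycle σ m)) = l₂.map (x T σ) :=
        List.map_congr_left fun j hj => hoff j (by simp [hj]) (hn2 j hj)
      have e1' : l₁.map (x (insert m T) σ) = l₁.map (x T σ) :=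
        List.map_congr_left fun j hj => hoff' j (hn1 j hj)
      have e2' : l₂.map (x (insert m T) σ) = l₂.map (x T σ) :=
        List.map_congr_left fun j hj => hoff' j (hn2 j hj)
      simp only [List.map_append, List.map_cons, List.prod_append, List.prod_cons, e1, e2, e1',
        e2', hm1]
      generalize (l₁.map (x T σ)).prod = a
      generalize (l₂.map (x T σ)).prod = b
      rw [← mul_add, ← mul_add, ← add_mul, hm2]
      simp only [two_mul, add_mul, mul_add]
    · have : (L σ).map (x (insert m T) σ) = (L σ).map (x T σ) :=
        List.map_congr_left fun j hj => by
          have : j ≠ m := fun e => h (e ▸ hj)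
          simp [x, this]
      simp only [φ, if_neg h, this, two_mul]

end Hermitian

/-! ### Complex representation and the symplectic form -/

section QuaternionMatrices

open Quaternion ComplexConjugate

/-- The two-dimensional complex representation of the quaternions. -/
noncomputable def quatToMatrix : ℍ[ℝ] →+* Matrix Bool Bool ℂ where
  toFun q := Matrix.of fun a b =>
    match a, b with
    | false, false => ⟨q.re, q.imI⟩
    | false, true => ⟨q.imJ, q.imK⟩
    | true, false => ⟨-q.imJ, q.imK⟩
    | true, true => ⟨q.re, -q.imI⟩
  map_zero' := by
    ext a b; cases a <;> cases b <;> apply Complex.ext <;> simp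
  map_one' := by
    ext a b; cases a <;> cases b <;> apply Complex.ext <;> simp
  map_add' p q := by
    ext a b; cases a <;> cases b <;> apply Complex.ext <;> simp <;> ring
  map_mul' p q := by
    ext a b; cases a <;> cases b <;> apply Complex.ext <;> simp [Matrix.mul_apply] <;> ring

theorem trace_quatToMatrix (q : ℍ[ℝ]) : (quatToMatrix q).trace = ((2 * q.re : ℝ) : ℂ) := by
  apply Complex.ext <;> simp [quatToMatrix, Matrix.trace, two_mul]

theorem quatToMatrix_star (q : ℍ[ℝ]) :
    quatToMatrix (star q) = (quatToMatrix q).conjTranspose := by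
  ext a b; cases a <;> cases b <;> apply Complex.ext <;> simp [quatToMatrix]

/-- This is the entrywise form of `Q(q*) J = J Q(q)ᵀ` for 2 × 2 blocks. -/
theorem quatToMatrix_star_apply (q : ℍ[ℝ]) (a b : Bool) :
    (if b then 1 else -1) * quatToMatrix (star q) a (!b) =
      (if a then -1 else 1) * quatToMatrix q b (!a) := by
  cases a <;> cases b <;> apply Complex.ext <;> simp [quatToMatrix]

/-- The complex matrix of a quaternion matrix. -/
noncomputable def toComplexMatrix :
    Matrix (Fin n) (Fin n) ℍ[ℝ] →+* Matrix (Fin n × Bool) (Fin n × Bool) ℂ :=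
  (Matrix.compRingEquiv (Fin n) Bool ℂ).toRingHom.comp quatToMatrix.mapMatrix

theorem toComplexMatrix_apply (A : Matrix (Fin n) (Fin n) ℍ[ℝ]) (x y : Fin n × Bool) :
    toComplexMatrix A x y = quatToMatrix (A x.1 y.1) x.2 y.2 := rfl

theorem toComplexMatrix_conjTranspose (A : Matrix (Fin n) (Fin n) ℍ[ℝ]) :
    toComplexMatrix A.conjTranspose = (toComplexMatrix A).conjTranspose := by
  ext1 x y
  simp [toComplexMatrix_apply, quatToMatrix_star]

/-- The standard symplectic matrix. -/
noncomputable def symplecticMatrix (n : ℕ) : Matrix (Fin n × Bool) (Fin n × Bool) ℂ :=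
  Matrix.of fun x y => if x = (y.1, !y.2) then (if y.2 then 1 else -1) else 0

theorem mul_symplecticMatrix_apply (Y : Matrix (Fin n × Bool) (Fin n × Bool) ℂ)
    (x y : Fin n × Bool) :
    (Y * symplecticMatrix n) x y = (if y.2 then 1 else -1) * Y x (y.1, !y.2) := by
  simp [Matrix.mul_apply, symplecticMatrix]

theorem symplecticMatrix_mul_apply (Y : Matrix (Fin n × Bool) (Fin n × Bool) ℂ)
    (x y : Fin n × Bool) :
    (symplecticMatrix n * Y) x y = (if x.2 then -1 else 1) * Y (x.1, !x.2) y := by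
  have : ∀ z : Fin n × Bool, x = (z.1, !z.2) ↔ z = (x.1, !x.2) := by
    rintro ⟨z, b⟩
    obtain ⟨x, a⟩ := x
    cases a <;> cases b <;> simp [eq_comm]
  simp only [Matrix.mul_apply, symplecticMatrix, Matrix.of_apply, this, ite_mul, zero_mul]
  cases x.2 <;> simp

theorem toComplexMatrix_conjTranspose_mul_symplecticMatrix (A : Matrix (Fin n) (Fin n) ℍ[ℝ]) :
    toComplexMatrix A.conjTranspose * symplecticMatrix n =
      symplecticMatrix n * (toComplexMatrix A).transpose := by
  ext1 x y
  rw [mul_symplecticMatrix_apply, symplecticMatrix_mul_apply, Matrix.transpose_apply]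
  exact quatToMatrix_star_apply _ _ _

/-- For Hermitian `H` with complex matrix `X`, `X J = J Xᵀ`, and `J` is skew. -/
theorem transpose_toComplexMatrix_mul_symplecticMatrix {H : Matrix (Fin n) (Fin n) ℍ[ℝ]}
    (hH : H.IsHermitian) : (toComplexMatrix H * symplecticMatrix n).transpose =
      -(toComplexMatrix H * symplecticMatrix n) := by
  nth_rw 2 [← hH.eq]
  rw [toComplexMatrix_conjTranspose_mul_symplecticMatrix]
  ext1 x y
  rw [Matrix.transpose_apply, mul_symplecticMatrix_apply, Matrix.neg_apply,
    symplecticMatrix_mul_apply, Matrix.transpose_apply]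
  cases x.2 <;> simp

/-- If `B` and `X` are the complex matrices of `A` and `H`, moving `J` past that of `A*` gives `B (X
J) Bᵀ`, to which the Pfaffian rule applies. -/
theorem spinDet_toComplexMatrix_mul_mul_conjTranspose (A : Matrix (Fin n) (Fin n) ℍ[ℝ])
    {H : Matrix (Fin n) (Fin n) ℍ[ℝ]} (hH : H.IsHermitian) :
    spinDet (toComplexMatrix (A * H * A.conjTranspose)) =
      (toComplexMatrix A).det * spinDet (toComplexMatrix H) := by
  have hpf : ∀ {H : Matrix (Fin n) (Fin n) ℍ[ℝ]}, H.IsHermitian →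
      pf (toComplexMatrix H * symplecticMatrix n) =
        (Fintype.card ((Fin n → Bool) × Perm (Fin n)) : ℂ) * spinDet (toComplexMatrix H) :=
    fun hH => pf_eq_spinDet (transpose_toComplexMatrix_mul_symplecticMatrix hH)
      fun x k b => mul_symplecticMatrix_apply _ x (k, b)
  have h0 : (Fintype.card ((Fin n → Bool) × Perm (Fin n)) : ℂ) ≠ 0 :=
    Nat.cast_ne_zero.2 Fintype.card_ne_zero
  refine mul_left_cancel₀ h0 ?_
  rw [← hpf (Matrix.isHermitian_mul_mul_conjTranspose A hH), mul_left_comm, ← hpf hH,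
    ← pf_mul_mul_transpose, map_mul, map_mul, mul_assoc,
    toComplexMatrix_conjTranspose_mul_symplecticMatrix]
  simp only [mul_assoc]

/-- Only the identity permutation contributes; its `2 ^ n` colourings cancel its weight. -/
theorem spinDet_one {K : Type*} [Field K] [CharZero K] :
    spinDet (1 : Matrix (Fin n × Bool) (Fin n × Bool) K) = 1 := by
  rw [spinDet, Finset.sum_eq_single 1]
  · have h : ∀ s : Fin n → Bool, ∏ k, (1 : Matrix (Fin n × Bool) (Fin n × Bool) K) (k, s k)
        ((1 : Perm (Fin n)) k, s ((1 : Perm (Fin n)) k)) = 1 :=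
      fun s => Finset.prod_eq_one fun k _ => Matrix.one_apply_eq _
    simp_rw [h]
    simp [invCount]
  · intro σ _ hσ
    obtain ⟨k, hk⟩ : ∃ k, σ k ≠ k := by
      by_contra! h
      exact hσ (Equiv.ext h)
    refine mul_eq_zero_of_right _ (Finset.sum_eq_zero fun s _ =>
      Finset.prod_eq_zero (Finset.mem_univ k) (Matrix.one_apply_ne fun h => hk ?_))
    exact (congrArg Prod.fst h).symm
  · simp

/-- Each cycle contributes a trace, twice a real part; the factors 2 cancel `invCount σ`. -/
theorem IsCycleReps.sum_prod_toComplexMatrix {σ : Perm (Fin n)} {L : List (Fin n)}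
    (h : IsCycleReps σ L) (H : Matrix (Fin n) (Fin n) ℍ[ℝ]) :
    (invCount σ : ℂ)⁻¹ * ∑ s : Fin n → Bool, ∏ k, toComplexMatrix H (k, s k) (σ k, s (σ k)) =
      (((L.map fun j => (cycleProd H σ j).re).prod : ℝ) : ℂ) := by
  have h1 := h.sum_prod_eq fun k => quatToMatrix (H k (σ k))
  have h2 : ∀ j, (((List.range (Function.minimalPeriod σ j)).map
      fun k => quatToMatrix (H ((σ ^ k) j) (σ ((σ ^ k) j)))).prod).trace =
      2 * (((cycleProd H σ j).re : ℝ) : ℂ) := by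
    intro j
    rw [cycleProd, ← Complex.ofReal_ofNat, ← Complex.ofReal_mul, ← trace_quatToMatrix,
      map_list_prod, List.map_map]
    simp only [Function.comp_def, pow_succ', Perm.mul_apply]
  simp_rw [h2] at h1
  simp_rw [toComplexMatrix_apply]
  rw [h1, List.prod_map_mul, h.two_pow_length]
  have h3 : (((L.map fun j => (cycleProd H σ j).re).prod : ℝ) : ℂ) =
      (L.map fun j => (((cycleProd H σ j).re : ℝ) : ℂ)).prod := by
    rw [← Complex.ofRealHom_eq_coe, map_list_prod, List.map_map]
    rfl
  rw [h3]
  simp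

theorem sum_sign_mul_prod_eq_spinDet {H : Matrix (Fin n) (Fin n) ℍ[ℝ]} (hH : H.IsHermitian)
    (L : Perm (Fin n) → List (Fin n)) (hL : ∀ σ, IsCycleReps σ (L σ))
    (hL' : ∀ σ τ, (∀ x y, τ.SameCycle x y ↔ σ.SameCycle x y) → L τ = L σ) :
    ∃ r : ℝ, (r : ℂ) = spinDet (toComplexMatrix H) ∧
      ∑ σ, ((Perm.sign σ : ℤ) : ℍ[ℝ]) * ((L σ).map (cycleProd H σ)).prod = r := by
  refine ⟨∑ σ, ((Perm.sign σ : ℤ) : ℝ) * ((L σ).map fun j => (cycleProd H σ j).re).prod, ?_, ?_⟩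
  · rw [spinDet, Complex.ofReal_sum]
    refine Finset.sum_congr rfl fun σ _ => ?_
    rw [mul_assoc, (hL σ).sum_prod_toComplexMatrix H]
    push_cast
    rfl
  · rw [sum_sign_mul_prod_eq_sum_re hH L hL hL', ← Quaternion.algebraMap_def, map_sum]
    refine Finset.sum_congr rfl fun σ _ => ?_
    rw [map_mul, map_intCast, map_list_prod, List.map_map]
    rfl

theorem cycleStarts_congr {σ τ : Perm (Fin n)} (i : Fin n)
    (h : ∀ x y, τ.SameCycle x y ↔ σ.SameCycle x y) : cycleStarts τ i = cycleStarts σ i := by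
  simp only [cycleStarts, h]

theorem IsCycleReps.reverse {σ : Perm (Fin n)} {L : List (Fin n)} (h : IsCycleReps σ L) :
    IsCycleReps σ L.reverse where
  nodup := List.nodup_reverse.2 h.nodup
  eq_of_sameCycle hj hk := h.eq_of_sameCycle (List.mem_reverse.1 hj) (List.mem_reverse.1 hk)
  exists_sameCycle x := by simpa using h.exists_sameCycle x

/-- All row and column determinants of a Hermitian quaternion matrix are equal to the same real
number. -/
theorem rdet_cdet_eq_of_isHermitian {H : Matrix (Fin n) (Fin n) ℍ[ℝ]} (hH : H.IsHermitian)
    {r : ℝ} (hr : (r : ℂ) = spinDet (toComplexMatrix H)) (i : Fin n) :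
    rdet i H = r ∧ cdet i H = r := by
  obtain ⟨a, ha, ha'⟩ := sum_sign_mul_prod_eq_spinDet hH (fun σ => cycleStarts σ i)
    (fun σ => isCycleReps_cycleStarts σ i) fun σ τ h => cycleStarts_congr i h
  obtain ⟨b, hb, hb'⟩ := sum_sign_mul_prod_eq_spinDet hH (fun σ => (cycleStarts σ i).reverse)
    (fun σ => (isCycleReps_cycleStarts σ i).reverse)
    fun σ τ h => congrArg List.reverse (cycleStarts_congr i h)
  rw [← hr, Complex.ofReal_inj] at ha hb
  exact ⟨ha'.trans (by rw [ha]), hb'.trans (by rw [hb])⟩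

/-- The complex determinant of a quaternion matrix is real, and it is the value of all row and
column determinants of `A * A.conjTranspose`. -/
theorem exists_det_toComplexMatrix_eq [NeZero n] (A : Matrix (Fin n) (Fin n) ℍ[ℝ]) :
    ∃ r : ℝ, (r : ℂ) = (toComplexMatrix A).det ∧ ∀ i,
      rdet i (A * A.conjTranspose) = r ∧ cdet i (A * A.conjTranspose) = r := by
  have h := spinDet_toComplexMatrix_mul_mul_conjTranspose A (H := 1) Matrix.isHermitian_one
  rw [mul_one, map_one, spinDet_one, mul_one] at h
  have hH := Matrix.isHermitian_mul_conjTranspose_self A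
  obtain ⟨r, hr, -⟩ := sum_sign_mul_prod_eq_spinDet hH (fun σ => (cycleStarts σ 0))
    (fun σ => isCycleReps_cycleStarts σ 0) fun σ τ h => cycleStarts_congr 0 h
  exact ⟨r, hr.trans h, rdet_cdet_eq_of_isHermitian hH hr⟩

end QuaternionMatrices

end RowColDet

/-- The double determinant over the real Hamilton quaternions is well defined (every row and
column determinant of `A A*` and of `A* A` gives the same value) and multiplicative. -/
theorem mainTheorem6 (n : ℕ) [NeZero n] :
    (∀ (A : Matrix (Fin n) (Fin n) (Quaternion ℝ)) (i : Fin n),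
      RowColDet.rdet i (A * A.conjTranspose) = RowColDet.ddet A ∧
      RowColDet.cdet i (A * A.conjTranspose) = RowColDet.ddet A ∧
      RowColDet.rdet i (A.conjTranspose * A) = RowColDet.ddet A ∧
      RowColDet.cdet i (A.conjTranspose * A) = RowColDet.ddet A) ∧
    ∀ A B : Matrix (Fin n) (Fin n) (Quaternion ℝ),
      RowColDet.ddet (A * B) = RowColDet.ddet A * RowColDet.ddet B := by
  open RowColDet in
  choose r hr hr' using exists_det_toComplexMatrix_eq (n := n)
  have hd : ∀ A, ddet A = (r A : Quaternion ℝ) := fun A => (hr' A 0).1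
  refine ⟨fun A i => ?_, fun A B => ?_⟩
  -- The complex determinant of `A*` is the conjugate of that of `A`, which is real.
  · have hs : r A.conjTranspose = r A := by
      rw [← Complex.ofReal_inj, hr, toComplexMatrix_conjTranspose, Matrix.det_conjTranspose, ← hr]
      exact Complex.conj_ofReal _
    have h := hr' A.conjTranspose i
    rw [Matrix.conjTranspose_conjTranspose, hs] at h
    rw [hd]
    exact ⟨(hr' A i).1, (hr' A i).2, h.1, h.2⟩
  · have hm : r (A * B) = r A * r B := by
      rw [← Complex.ofReal_inj, Complex.ofReal_mul, hr, hr, hr, map_mul, Matrix.det_mul]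
    rw [hd, hd, hd, hm, Quaternion.coe_mul]
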